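/- Let $s$ be the Fréchet space of complex sequences $\xi=(\xi_j)_{j\ge 1}$ with $|\xi|_q:=\big(\sum_{j}|\xi_j|^2j^{2q}\big)^{1/2}<\infty$ for all $q\in\mathbb N_0$, topologized by the norms $|\cdot|_q$, and let $s'$ be the space of complex sequences with $|\xi|'_q:=\big(\sum_{j}|\xi_j|^2j^{-2q}\big)^{1/2}<\infty$ for some $q\in\mathbb N_0$, with the locally convex inductive limit topology given by the norms $|\cdot|'_q$. Let $L(s',s)$ be the space of continuous linear operators $s'\to s$, regarded as a subset of the algebra $L(\ell_2)$ of bounded operators on $\ell_2$ by identifying $x$ with the composition $\ell_2\hookrightarrow s'\xrightarrow{x}s\hookrightarrow \ell_2$; normality and the spectrum $\sigma(x)$ refer to $L(\ell_2)$. A function $f:\sigma(x)\to\mathbb C$ is called Hölder continuous at zero if there are $\theta\in(0,1]$ and $C>0$ with $|f(t)-f(0)|\le C|t|^\theta$ for all $t\in\sigma(x)$ in some neighbourhood of $0$. (1) If $x\in L(s',s)$ is normal and $f:\sigma(x)\to\mathbb C$ is Hölder continuous at zero with $f(0)=0$, then $f$ is continuous on $\sigma(x)$, and the operator $f(x)$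 given by the continuous functional calculus in $L(\ell_2)$ belongs to $L(s',s)$. (2) In particular, if $x\in L(s',s)$ is normal with $\sigma(x)\subset[0,\infty)$, then $x^\theta\in L(s',s)$ for every $\theta\in(0,\infty)$. -/

import Mathlib

open Filter Topology

noncomputable section

/-- The complex Hilbert space `l_2`. The index `j : ℕ` stands for the `(j + 1)`-st coordinate. -/
abbrev HilbertL2 : Type := lp (fun _ : ℕ => ℂ) 2

/-- The weighted space of all complex sequences `ξ` with `∑ ‖ξ j‖ ^ 2 * (j + 1) ^ (2 * q) < ∞`,
for an integer `q`. -/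
def weightedL2 (q : ℤ) : Submodule ℂ (ℕ → ℂ) where
  carrier := {ξ | Memℓp (fun j : ℕ => ((j : ℂ) + 1) ^ q * ξ j) 2}
  zero_mem' := by
    have h : (fun j : ℕ => ((j : ℂ) + 1) ^ q * (0 : ℕ → ℂ) j) = 0 := by
      funext j; simp
    rw [Set.mem_ofPred_eq, h]
    exact zero_memℓp
  add_mem' := by
    intro ξ η hξ hη
    have h : (fun j : ℕ => ((j : ℂ) + 1) ^ q * (ξ + η) j)
        = (fun j : ℕ => ((j : ℂ) + 1) ^ q * ξ j) + (fun j : ℕ => ((j : ℂ) + 1) ^ q * η j) := by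
      funext j; simp [mul_add]
    rw [Set.mem_ofPred_eq, h]
    exact Memℓp.add hξ hη
  smul_mem' := by
    intro c ξ hξ
    have h : (fun j : ℕ => ((j : ℂ) + 1) ^ q * (c • ξ) j)
        = c • (fun j : ℕ => ((j : ℂ) + 1) ^ q * ξ j) := by
      funext j; simp [mul_left_comm]
    rw [Set.mem_ofPred_eq, h]
    exact Memℓp.const_smul hξ c

/-- Multiplication by the weight, from the weighted space to `l_2`. -/
def weightedL2ToL2 (q : ℤ) : weightedL2 q →ₗ[ℂ] HilbertL2 where
  toFun ξ := ⟨fun j : ℕ => ((j : ℂ) + 1) ^ q * ξ.1 j, ξ.2⟩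
  map_add' ξ η := by
    ext j
    exact mul_add _ _ _
  map_smul' c ξ := by
    ext j
    exact mul_left_comm _ _ _

/-- The norm of the weighted space, `(∑ ‖ξ j‖ ^ 2 * (j + 1) ^ (2 * q)) ^ (1 / 2)`. -/
def weightedNorm (q : ℤ) : Seminorm ℂ (weightedL2 q) :=
  (normSeminorm ℂ HilbertL2).comp (weightedL2ToL2 q)

theorem mem_weightedL2_iff (q : ℤ) (ξ : ℕ → ℂ) :
    ξ ∈ weightedL2 q ↔ Summable (fun j : ℕ => ‖ξ j‖ ^ 2 * ((j : ℝ) + 1) ^ (2 * q)) := by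
  change Memℓp (fun j : ℕ => ((j : ℂ) + 1) ^ q * ξ j) 2 ↔ _
  rw [memℓp_gen_iff (by norm_num)]
  refine summable_congr fun j => ?_
  have h : ‖(j : ℂ) + 1‖ = (j : ℝ) + 1 := by
    rw [← Nat.cast_succ, Complex.norm_natCast]; simp
  rw [norm_mul, norm_zpow, h, zpow_mul']
  norm_num
  rw [mul_pow, mul_comm]

theorem weightedNorm_apply (q : ℤ) (ξ : weightedL2 q) :
    weightedNorm q ξ = Real.sqrt (∑' j : ℕ, ‖ξ.1 j‖ ^ 2 * ((j : ℝ) + 1) ^ (2 * q)) := by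
  change ‖weightedL2ToL2 q ξ‖ = _
  rw [lp.norm_eq_tsum_rpow (by norm_num), Real.sqrt_eq_rpow]
  norm_num
  congr 1
  · refine tsum_congr fun j => ?_
    have h : ‖(j : ℂ) + 1‖ = (j : ℝ) + 1 := by
      rw [← Nat.cast_succ, Complex.norm_natCast]; simp
    change ‖((j : ℂ) + 1) ^ q * ξ.1 j‖ ^ _ = _
    rw [norm_mul, norm_zpow, h, zpow_mul']
    norm_num
    rw [mul_pow, mul_comm]

/-- The space `s` of rapidly decreasing sequences: those lying in the weighted space of
exponent `q` for every `q ∈ {0, 1, 2, …}`. -/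
def RapidSeq : Type := ↥(⨅ q : ℕ, weightedL2 (q : ℤ))

instance : AddCommGroup RapidSeq := inferInstanceAs (AddCommGroup ↥(⨅ q : ℕ, weightedL2 (q : ℤ)))
instance : Module ℂ RapidSeq := inferInstanceAs (Module ℂ ↥(⨅ q : ℕ, weightedL2 (q : ℤ)))

/-- The inclusion of `s` into its `q`-th step. -/
def RapidSeq.toWeighted (q : ℕ) : RapidSeq →ₗ[ℂ] weightedL2 (q : ℤ) :=
  Submodule.inclusion (iInf_le (fun q : ℕ => weightedL2 (q : ℤ)) q)

/-- The norms `|·|_q` of `s`. -/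
def rapidNorm : SeminormFamily ℂ RapidSeq ℕ :=
  fun q => (weightedNorm (q : ℤ)).comp (RapidSeq.toWeighted q)

/-- The Fréchet topology of `s`, generated by the norms `|·|_q`. -/
instance : TopologicalSpace RapidSeq := rapidNorm.moduleFilterBasis.topology

theorem RapidSeq.withSeminorms : WithSeminorms rapidNorm := ⟨rfl⟩

theorem weightedL2_antitone : Antitone weightedL2 := by
  intro p q hpq ξ hξ
  rw [mem_weightedL2_iff] at hξ ⊢
  refine Summable.of_nonneg_of_le (fun j => by positivity) (fun j => ?_) hξ
  have h : (1 : ℝ) ≤ (j : ℝ) + 1 := by simp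
  gcongr

/-- The space `s'` of slowly increasing sequences: those lying in the weighted space of
exponent `-q` for some `q ∈ {0, 1, 2, …}`. -/
def slowSubmodule : Submodule ℂ (ℕ → ℂ) where
  carrier := {ξ | ∃ q : ℕ, ξ ∈ weightedL2 (-(q : ℤ))}
  zero_mem' := ⟨0, zero_mem _⟩
  add_mem' := by
    rintro ξ η ⟨p, hp⟩ ⟨q, hq⟩
    refine ⟨max p q, add_mem (weightedL2_antitone ?_ hp) (weightedL2_antitone ?_ hq)⟩ <;>
    · push_cast
      simp
  smul_mem' := by
    rintro c ξ ⟨q, hq⟩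
    exact ⟨q, Submodule.smul_mem _ c hq⟩

/-- The space `s'` as a type, to carry its inductive limit topology. -/
def SlowSeq : Type := ↥slowSubmodule

instance : AddCommGroup SlowSeq := inferInstanceAs (AddCommGroup ↥slowSubmodule)
instance : Module ℂ SlowSeq := inferInstanceAs (Module ℂ ↥slowSubmodule)

/-- The inclusion of the `q`-th step into `s'`. -/
def SlowSeq.ofWeighted (q : ℕ) : weightedL2 (-(q : ℤ)) →ₗ[ℂ] SlowSeq :=
  Submodule.inclusion (p' := slowSubmodule) (fun _ hξ => Exists.intro q hξ)

/-- The seminorms on `s'` whose restriction to every step is continuous, that is, bounded by a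
multiple of the norm `|·|'_q` of that step. -/
def IsStepContinuous (p : Seminorm ℂ SlowSeq) : Prop :=
  ∀ q : ℕ, ∃ C : ℝ, ∀ ξ : weightedL2 (-(q : ℤ)),
    p (SlowSeq.ofWeighted q ξ) ≤ C * weightedNorm (-(q : ℤ)) ξ

/-- The family of all seminorms that are continuous on every step. -/
def slowSeminorms : SeminormFamily ℂ SlowSeq {p : Seminorm ℂ SlowSeq // IsStepContinuous p} :=
  fun p => p.1

instance : Nonempty {p : Seminorm ℂ SlowSeq // IsStepContinuous p} :=
  ⟨⟨0, fun _ => ⟨0, fun _ => by simp⟩⟩⟩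

/-- The (locally convex) inductive limit topology of `s'`: the one generated by all seminorms
that are continuous on every step. -/
instance : TopologicalSpace SlowSeq := slowSeminorms.moduleFilterBasis.topology

theorem SlowSeq.withSeminorms : WithSeminorms slowSeminorms := ⟨rfl⟩

theorem memℓp_of_mem_weightedL2 {q : ℤ} (hq : q = 0) {ξ : ℕ → ℂ} (h : ξ ∈ weightedL2 q) :
    Memℓp ξ 2 := by
  subst hq
  have h' : Memℓp (fun j : ℕ => ((j : ℂ) + 1) ^ (0 : ℤ) * ξ j) 2 := h
  simpa only [zpow_zero, one_mul] using h'

theorem mem_weightedL2_of_memℓp {q : ℤ} (hq : q = 0) {ξ : ℕ → ℂ} (h : Memℓp ξ 2) :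
    ξ ∈ weightedL2 q := by
  subst hq
  change Memℓp (fun j : ℕ => ((j : ℂ) + 1) ^ (0 : ℤ) * ξ j) 2
  simpa only [zpow_zero, one_mul] using h

theorem weightedNorm_eq_norm {q : ℤ} (hq : q = 0) (ξ : weightedL2 q) (η : HilbertL2)
    (h : ∀ j, ξ.1 j = η j) : weightedNorm q ξ = ‖η‖ := by
  subst hq
  have : weightedL2ToL2 0 ξ = η := by
    ext j
    change ((j : ℂ) + 1) ^ (0 : ℤ) * ξ.1 j = _
    rw [zpow_zero, one_mul, h j]
  rw [← this]
  rfl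

/-- The canonical inclusion of `s` into `l_2`. -/
def rapidToL2Linear : RapidSeq →ₗ[ℂ] HilbertL2 where
  toFun ξ := ⟨ξ.1, memℓp_of_mem_weightedL2 Nat.cast_zero (RapidSeq.toWeighted 0 ξ).2⟩
  map_add' _ _ := rfl
  map_smul' _ _ := rfl

instance : IsTopologicalAddGroup RapidSeq := RapidSeq.withSeminorms.topologicalAddGroup
instance : IsTopologicalAddGroup SlowSeq := SlowSeq.withSeminorms.topologicalAddGroup

theorem continuous_rapidToL2Linear : Continuous rapidToL2Linear := by
  refine WithSeminorms.continuous_normedSpace_rng _ RapidSeq.withSeminorms _ ⟨{0}, 1, ?_⟩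
  intro ξ
  have h := weightedNorm_eq_norm Nat.cast_zero (RapidSeq.toWeighted 0 ξ) (rapidToL2Linear ξ)
    (fun _ => rfl)
  rw [Finset.sup_singleton, one_smul]
  exact h.ge

/-- The canonical continuous inclusion of `s` into `l_2`. -/
def rapidToL2 : RapidSeq →L[ℂ] HilbertL2 := ⟨rapidToL2Linear, continuous_rapidToL2Linear⟩

theorem neg_natCast_zero : -((0 : ℕ) : ℤ) = 0 := by simp

/-- The canonical inclusion of `l_2` into `s'`. -/
def l2ToSlowLinear : HilbertL2 →ₗ[ℂ] SlowSeq where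
  toFun ξ := SlowSeq.ofWeighted 0 ⟨ξ.1, mem_weightedL2_of_memℓp neg_natCast_zero ξ.2⟩
  map_add' _ _ := rfl
  map_smul' _ _ := rfl

theorem continuous_l2ToSlowLinear : Continuous l2ToSlowLinear := by
  refine WithSeminorms.continuous_normedSpace_dom _ SlowSeq.withSeminorms _ ?_
  intro p
  obtain ⟨C, hC⟩ := p.2 0
  refine ⟨C.toNNReal, fun ξ => ?_⟩
  refine (hC ⟨ξ.1, mem_weightedL2_of_memℓp neg_natCast_zero ξ.2⟩).trans ?_
  rw [weightedNorm_eq_norm neg_natCast_zero _ ξ (fun _ => rfl)]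
  exact mul_le_mul_of_nonneg_right (Real.le_coe_toNNReal C) (norm_nonneg ξ)

/-- The canonical continuous inclusion of `l_2` into `s'`. -/
def l2ToSlow : HilbertL2 →L[ℂ] SlowSeq := ⟨l2ToSlowLinear, continuous_l2ToSlowLinear⟩

/-- The space `L(s', s)` of continuous linear operators from `s'` to `s` (smooth operators). -/
abbrev SmoothOperator : Type := SlowSeq →L[ℂ] RapidSeq

/-- The canonical embedding of `L(s', s)` into `L(l_2)`, sending `x` to the composition
`l_2 ↪ s' → s ↪ l_2`. -/
def SmoothOperator.toL2 (x : SmoothOperator) : HilbertL2 →L[ℂ] HilbertL2 :=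
  rapidToL2 ∘L x ∘L l2ToSlow

/-- `f : X → ℂ` is Hölder continuous at zero: `‖f t - f 0‖ ≤ C * ‖t‖ ^ θ` for all `t ∈ X` in a
neighbourhood of `0`, for some `θ ∈ (0, 1]` and `C > 0`. -/
def HolderAtZeroOn (f : ℂ → ℂ) (X : Set ℂ) : Prop :=
  ∃ θ : ℝ, 0 < θ ∧ θ ≤ 1 ∧ ∃ C : ℝ, 0 < C ∧ ∀ᶠ t in 𝓝[X] 0, ‖f t - f 0‖ ≤ C * ‖t‖ ^ θ

end

/-! Write T for `x.toL2` and e_j for the unit vectors. Continuity of x on s' makes ‖T e_j‖ decay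
faster than every power of j (`SmoothOperator.norm_toL2_single_le`). Repeated Cauchy–Schwarz gives
‖|T|^a e_j‖ ≤ ‖T e_j‖^a for a = 2^(-n) (`norm_cfc_dyadic_pow_le`), so rapid decay survives
arbitrarily small powers of |T|. If 2a < θ, Hölder continuity at zero makes g = f / |z|^(2a)
continuous, and f(T) = |T|^a g(T) |T|^a has entries ⟨|T|^a e_i, g(T) |T|^a e_j⟩ that decay rapidly
in both indices. Such a matrix comes from an operator s' → s (`exists_smoothOperator_toL2_eq`).
Continuity of f is an issue only at 0: T is normal and Hilbert–Schmidt, so its spectrum is finite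
outside every disc about 0 (`finite_spectrum_inter_norm_ge`). -/

/-! ### Moment inequalities for powers of |T|. -/

/-- Square root estimate: if `g = h ^ 2` with `h` real-valued, then
`‖h(T) e‖ ^ 2 ≤ ‖g(T) e‖ * ‖e‖`. -/
theorem sq_norm_cfc_apply_le {E : Type*} [NormedAddCommGroup E] [InnerProductSpace ℂ E]
    [CompleteSpace E] (T : E →L[ℂ] E) (h : ℂ → ℝ)
    (hc : Continuous h) (e : E) :
    ‖cfc (fun z => (h z : ℂ)) T e‖ ^ 2 ≤ ‖cfc (fun z => ((h z ^ 2 : ℝ) : ℂ)) T e‖ * ‖e‖ := by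
  have hs : star (cfc (fun z => (h z : ℂ)) T) = cfc (fun z => (h z : ℂ)) T := by
    rw [← cfc_star]; simp
  have hm : cfc (fun z => ((h z ^ 2 : ℝ) : ℂ)) T
      = star (cfc (fun z => (h z : ℂ)) T) * cfc (fun z => (h z : ℂ)) T := by
    rw [hs, ← cfc_mul _ _ T]
    refine cfc_congr fun z _ => ?_
    push_cast; ring
  rw [hm]
  have h1 : ((‖cfc (fun z => (h z : ℂ)) T e‖ ^ 2 : ℝ) : ℂ) =
      inner ℂ ((star (cfc (fun z => (h z : ℂ)) T) * cfc (fun z => (h z : ℂ)) T) e) e := by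
    rw [ContinuousLinearMap.star_eq_adjoint, mul_apply_eq_comp,
      ContinuousLinearMap.adjoint_inner_left, inner_self_eq_norm_sq_to_K]
    norm_cast
  have h2 := norm_inner_le_norm (𝕜 := ℂ)
    ((star (cfc (fun z => (h z : ℂ)) T) * cfc (fun z => (h z : ℂ)) T) e) e
  rw [← h1, Complex.norm_real, Real.norm_of_nonneg (sq_nonneg _)] at h2
  exact h2

theorem IsStarNormal.norm_adjoint_apply {E : Type*} [NormedAddCommGroup E] [InnerProductSpace ℂ E]
    [CompleteSpace E] {T : E →L[ℂ] E} (hT : IsStarNormal T) (e : E) :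
    ‖ContinuousLinearMap.adjoint T e‖ = ‖T e‖ :=
  (ContinuousLinearMap.isStarNormal_iff_norm_eq_adjoint.1 hT e).symm

/-- Both squares equal ⟨T*T e, e⟩, because |T|*|T| = T*T. -/
theorem norm_cfc_norm_apply {E : Type*} [NormedAddCommGroup E] [InnerProductSpace ℂ E]
    [CompleteSpace E] (T : E →L[ℂ] E) (hT : IsStarNormal T) (e : E) :
    ‖cfc (fun z : ℂ => (‖z‖ : ℂ)) T e‖ = ‖T e‖ := by
  have key : ∀ S : E →L[ℂ] E, ((‖S e‖ ^ 2 : ℝ) : ℂ) = inner ℂ ((star S * S) e) e := by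
    intro S
    rw [ContinuousLinearMap.star_eq_adjoint, mul_apply_eq_comp,
      ContinuousLinearMap.adjoint_inner_left, inner_self_eq_norm_sq_to_K]
    norm_cast
  have hm : star (cfc (fun z : ℂ => (‖z‖ : ℂ)) T) * cfc (fun z : ℂ => (‖z‖ : ℂ)) T
      = star T * T := by
    conv_rhs => rw [← cfc_id' ℂ T, ← cfc_star, ← cfc_mul _ _ T]
    rw [← cfc_star, ← cfc_mul _ _ T]
    refine cfc_congr fun z _ => ?_
    simp only [RCLike.star_def, Complex.conj_ofReal]
    rw [Complex.conj_mul']; ring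
  have h := key (cfc (fun z : ℂ => (‖z‖ : ℂ)) T)
  rw [hm, ← key T] at h
  have h' := Complex.ofReal_injective h
  exact (sq_eq_sq₀ (norm_nonneg _) (norm_nonneg _)).1 h'

/-- Moment inequality for the dyadic powers of `|T|`. -/
theorem norm_cfc_dyadic_pow_le {E : Type*} [NormedAddCommGroup E] [InnerProductSpace ℂ E]
    [CompleteSpace E] (T : E →L[ℂ] E) (hT : IsStarNormal T) (n : ℕ) {e : E} (he : ‖e‖ ≤ 1) :
    ‖cfc (fun z : ℂ => ((‖z‖ ^ ((1 / 2 : ℝ) ^ n) : ℝ) : ℂ)) T e‖ ^ 2 ^ n ≤ ‖T e‖ := by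
  induction n with
  | zero => simpa using (norm_cfc_norm_apply T hT e).le
  | succ n ih =>
    have h := sq_norm_cfc_apply_le T (fun z => ‖z‖ ^ ((1 / 2 : ℝ) ^ (n + 1)))
      (Continuous.rpow_const continuous_norm fun _ => Or.inr (by positivity)) e
    have h2 : (fun z : ℂ => (((‖z‖ ^ ((1 / 2 : ℝ) ^ (n + 1))) ^ 2 : ℝ) : ℂ))
        = fun z : ℂ => ((‖z‖ ^ ((1 / 2 : ℝ) ^ n) : ℝ) : ℂ) := by
      funext z
      rw [← Real.rpow_natCast, ← Real.rpow_mul (norm_nonneg z)]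
      congr 2
      rw [pow_succ]; push_cast; ring
    rw [h2] at h
    rw [pow_succ' 2 n, pow_mul]
    refine (pow_le_pow_left₀ (by positivity) (h.trans ?_) _).trans ih
    exact mul_le_of_le_one_right (norm_nonneg _) he

theorem norm_lp_single_one (j : ℕ) : ‖(lp.single 2 j (1 : ℂ) : HilbertL2)‖ = 1 := by
  rw [lp.norm_single (by norm_num)]; simp

/-! ### Lower bounds and Hilbert–Schmidt sums for normal operators. -/

/-- A normal operator is bounded below on the range of a function of it that vanishes on a
neighbourhood of zero. -/
theorem le_norm_apply_cfc {E : Type*} [NormedAddCommGroup E] [InnerProductSpace ℂ E]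
    [CompleteSpace E] (T : E →L[ℂ] E) (hT : IsStarNormal T) {r : ℝ} (hr : 0 < r) (φ : ℂ → ℂ)
    (hφ : Continuous φ) (h0 : ∀ z, ‖z‖ ≤ r → φ z = 0) (u : E) :
    r * ‖cfc φ T u‖ ≤ ‖T (cfc φ T u)‖ := by
  -- A continuous substitute for 1/z: it equals 1/z where ‖z‖ ≥ r and is bounded by 1/r everywhere.
  let ψ : ℂ → ℂ := fun z => star z / ((max ‖z‖ r ^ 2 : ℝ) : ℂ)
  have hpos : ∀ z : ℂ, 0 < max ‖z‖ r := fun z => lt_max_of_lt_right hr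
  have hψ : Continuous ψ := by
    refine continuous_star.div (by fun_prop) fun z => ?_
    exact_mod_cast (pow_pos (hpos z) 2).ne'
  have hm : cfc φ T = cfc ψ T * (T * cfc φ T) := by
    conv_rhs => enter [2, 1]; rw [← cfc_id' ℂ T]
    rw [← cfc_mul _ _ T, ← cfc_mul _ _ T]
    refine cfc_congr fun z _ => ?_
    dsimp only [ψ]
    by_cases hz : ‖z‖ ≤ r
    · simp [h0 z hz]
    · have hz' : max ‖z‖ r = ‖z‖ := max_eq_left (le_of_not_ge hz)
      have hz0 : (‖z‖ : ℂ) ≠ 0 := by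
        have : 0 < ‖z‖ := hr.trans (lt_of_not_ge hz)
        exact_mod_cast this.ne'
      rw [hz', ← mul_assoc, div_mul_eq_mul_div, RCLike.star_def, Complex.conj_mul']
      push_cast
      field_simp
  have hn : ‖cfc ψ T‖ ≤ r⁻¹ := by
    refine norm_cfc_le (by positivity) fun z _ => ?_
    dsimp only [ψ]
    rw [norm_div, norm_star, Complex.norm_real, Real.norm_of_nonneg (by positivity), div_le_iff₀
      (pow_pos (hpos z) 2), pow_two, ← mul_assoc]
    refine (le_max_left ‖z‖ r).trans (le_mul_of_one_le_left (hpos z).le ?_)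
    rw [← inv_mul_cancel₀ hr.ne']
    gcongr
    exact le_max_right _ _
  have h1 : ‖cfc φ T u‖ ≤ r⁻¹ * ‖T (cfc φ T u)‖ := by
    calc ‖cfc φ T u‖ = ‖cfc ψ T (T (cfc φ T u))‖ := by
          conv_lhs => rw [hm]
          rfl
      _ ≤ ‖cfc ψ T‖ * ‖T (cfc φ T u)‖ := ContinuousLinearMap.le_opNorm _ _
      _ ≤ _ := by gcongr
  rwa [inv_mul_eq_div, le_div_iff₀ hr, mul_comm] at h1

/-- The Hilbert–Schmidt sum of a normal operator on `ℓ²` bounds the sum over every finite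
orthonormal family. -/
theorem sum_sq_norm_apply_le {T : HilbertL2 →L[ℂ] HilbertL2} (hT : IsStarNormal T)
    (hs : Summable fun j : ℕ => ‖T (lp.single 2 j 1)‖ ^ 2) {ι : Type*} [Fintype ι]
    {v : ι → HilbertL2} (hv : Orthonormal ℂ v) :
    ∑ k, ‖T (v k)‖ ^ 2 ≤ ∑' j : ℕ, ‖T (lp.single 2 j 1)‖ ^ 2 := by
  have h1 : ∀ k, HasSum (fun j : ℕ => ‖inner ℂ (v k) (T (lp.single 2 j 1))‖ ^ 2)
      (‖T (v k)‖ ^ 2) := by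
    intro k
    -- Normality replaces T by its adjoint, so that Parseval turns ‖T* v_k‖² into a sum over the T
    -- e_j; Bessel in k then finishes.
    rw [← hT.norm_adjoint_apply]
    have h := lp.hasSum_norm (p := 2) (by norm_num) (ContinuousLinearMap.adjoint T (v k))
    simp only [ENNReal.toReal_ofNat, Real.rpow_ofNat] at h
    convert h using 3 with j
    have h3 := lp.inner_single_left (𝕜 := ℂ) (G := fun _ : ℕ => ℂ) j (1 : ℂ)
      (ContinuousLinearMap.adjoint T (v k))
    rw [ContinuousLinearMap.adjoint_inner_right] at h3
    rw [norm_inner_symm, h3]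
    simp
  have h2 := hasSum_sum (s := Finset.univ) fun k _ => h1 k
  exact hasSum_le (fun j => hv.sum_inner_products_le _) h2 hs.hasSum
-- Smooth operators and rapidly decreasing matrices.
theorem summable_inv_natCast_add_one_sq : Summable fun j : ℕ => (((j : ℝ) + 1) ^ 2)⁻¹ := by
  have := (summable_nat_add_iff 1).2 (Real.summable_nat_pow_inv (p := 2) |>.2 (by norm_num))
  simpa using this

theorem norm_le_mul_weightedNorm (q : ℕ) (ξ : weightedL2 (-(q : ℤ))) (j : ℕ) :
    ‖ξ.1 j‖ ≤ ((j : ℝ) + 1) ^ q * weightedNorm (-(q : ℤ)) ξ := by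
  have h := lp.norm_apply_le_norm (p := 2) (by norm_num) (weightedL2ToL2 (-(q : ℤ)) ξ) j
  change ‖((j : ℂ) + 1) ^ (-(q : ℤ)) * ξ.1 j‖ ≤ weightedNorm (-(q : ℤ)) ξ at h
  have h1 : ‖(j : ℂ) + 1‖ = (j : ℝ) + 1 := by
    rw [← Nat.cast_succ, Complex.norm_natCast]; simp
  rw [norm_mul, norm_zpow, h1, zpow_neg, zpow_natCast, inv_mul_le_iff₀ (by positivity)] at h
  exact h

/-- A sequence dominated by `(j + 1) ^ (-(p + 1))` lies in the `p`-th step, with a bound. -/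
theorem mem_weightedL2_of_norm_le (p : ℕ) {ξ : ℕ → ℂ} {M : ℝ}
    (h : ∀ j, ‖ξ j‖ ≤ M * (((j : ℝ) + 1) ^ (p + 1))⁻¹) :
    ∃ hξ : ξ ∈ weightedL2 (p : ℤ), weightedNorm (p : ℤ) ⟨ξ, hξ⟩ ≤
      M * Real.sqrt (∑' j : ℕ, (((j : ℝ) + 1) ^ 2)⁻¹) := by
  have hM : 0 ≤ M := by simpa using (norm_nonneg _).trans (h 0)
  have hle : ∀ j : ℕ, ‖ξ j‖ ^ 2 * ((j : ℝ) + 1) ^ (2 * (p : ℤ)) ≤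
      M ^ 2 * (((j : ℝ) + 1) ^ 2)⁻¹ := by
    intro j
    calc ‖ξ j‖ ^ 2 * ((j : ℝ) + 1) ^ (2 * (p : ℤ))
        ≤ (M * (((j : ℝ) + 1) ^ (p + 1))⁻¹) ^ 2 * ((j : ℝ) + 1) ^ (2 * (p : ℤ)) := by
          gcongr
          exact h j
      _ = M ^ 2 * (((j : ℝ) + 1) ^ 2)⁻¹ := by
          have : ((j : ℝ) + 1) ≠ 0 := by positivity
          have h2 : ((j : ℝ) + 1) ^ (2 * (p : ℤ)) = ((j : ℝ) + 1) ^ (2 * p) := by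
            exact_mod_cast zpow_natCast ((j : ℝ) + 1) (2 * p)
          rw [h2]
          field_simp
          ring
  have hsum := summable_inv_natCast_add_one_sq.mul_left (M ^ 2)
  have hS := Summable.of_nonneg_of_le (fun j => by positivity) hle hsum
  refine ⟨(mem_weightedL2_iff _ _).2 hS, ?_⟩
  rw [weightedNorm_apply]
  refine (Real.sqrt_le_sqrt (hS.tsum_le_tsum hle hsum)).trans ?_
  rw [tsum_mul_left, Real.sqrt_mul (sq_nonneg _), Real.sqrt_sq hM]

/-- The N-th step norm of e_j is exactly (j + 1)^(-N), and a continuous seminorm on s' is bounded by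
a multiple of each step norm. -/
theorem SmoothOperator.norm_toL2_single_le (x : SmoothOperator) (N : ℕ) :
    ∃ C : ℝ, ∀ j : ℕ, ‖x.toL2 (lp.single 2 j 1)‖ ≤ C * (((j : ℝ) + 1) ^ N)⁻¹ := by
  let g : SlowSeq →ₗ[ℂ] HilbertL2 := (rapidToL2 ∘L x).toLinearMap
  let p : Seminorm ℂ SlowSeq := (normSeminorm ℂ HilbertL2).comp g
  have hp : Continuous p := continuous_norm.comp (rapidToL2 ∘L x).continuous
  obtain ⟨s, C, -, hC⟩ := Seminorm.bound_of_continuous SlowSeq.withSeminorms p hp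
  have hstep : ∃ D : ℝ, 0 ≤ D ∧ ∀ ξ : weightedL2 (-(N : ℤ)),
      (s.sup slowSeminorms) (SlowSeq.ofWeighted N ξ) ≤ D * weightedNorm (-(N : ℤ)) ξ := by
    choose D hD using fun i : {p : Seminorm ℂ SlowSeq // IsStepContinuous p} => i.2 N
    refine ⟨∑ i ∈ s, |D i|, by positivity, fun ξ => ?_⟩
    refine Seminorm.finset_sup_apply_le (by positivity) fun i hi => (hD i ξ).trans ?_
    gcongr
    exact (le_abs_self _).trans (Finset.single_le_sum (f := fun i => |D i|)
      (fun _ _ => abs_nonneg _) hi)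
  obtain ⟨D, hD0, hD⟩ := hstep
  refine ⟨C * D, fun j => ?_⟩
  let e : HilbertL2 := lp.single 2 j 1
  have hmem : e.1 ∈ weightedL2 (-(N : ℤ)) :=
    weightedL2_antitone (by simp) (mem_weightedL2_of_memℓp rfl e.2)
  have he : l2ToSlow e = SlowSeq.ofWeighted N ⟨e.1, hmem⟩ := rfl
  have hn : weightedNorm (-(N : ℤ)) ⟨e.1, hmem⟩ = (((j : ℝ) + 1) ^ N)⁻¹ := by
    rw [weightedNorm_apply, tsum_eq_single j]
    · have : e.1 j = 1 := lp.single_apply_self _ _ _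
      rw [this, norm_one, one_pow, one_mul, zpow_mul', zpow_neg, zpow_natCast]
      exact Real.sqrt_sq (by positivity)
    · intro i hi
      have : e.1 i = 0 := lp.single_apply_ne _ _ _ hi
      simp [this]
  calc ‖x.toL2 e‖ = p (l2ToSlow e) := rfl
    _ ≤ C * (s.sup slowSeminorms) (l2ToSlow e) := hC _
    _ ≤ C * (D * weightedNorm (-(N : ℤ)) ⟨e.1, hmem⟩) := by
        rw [he]; gcongr; exact hD _
    _ = _ := by rw [hn, mul_assoc]

/-- Of the q + 2 powers of decay, q absorb the growth of ξ and two leave a summable majorant. -/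
theorem norm_mul_slowSeq_le {a : ℕ → ℂ} {K : ℝ} {q : ℕ}
    (ha : ∀ j : ℕ, ‖a j‖ ≤ K * (((j : ℝ) + 1) ^ (q + 2))⁻¹) (ξ : weightedL2 (-(q : ℤ))) (j : ℕ) :
    ‖a j * ξ.1 j‖ ≤ K * weightedNorm (-(q : ℤ)) ξ * (((j : ℝ) + 1) ^ 2)⁻¹ := by
  rw [norm_mul]
  calc ‖a j‖ * ‖ξ.1 j‖ ≤ (K * (((j : ℝ) + 1) ^ (q + 2))⁻¹) *
        (((j : ℝ) + 1) ^ q * weightedNorm (-(q : ℤ)) ξ) :=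
        mul_le_mul (ha j) (norm_le_mul_weightedNorm q ξ j) (norm_nonneg _)
          ((norm_nonneg _).trans (ha j))
    _ = _ := by
      have : ((j : ℝ) + 1) ≠ 0 := by positivity
      rw [pow_add]
      field_simp

/-- A rapidly decreasing matrix defines a continuous operator from `s'` to `s`. -/
theorem exists_smoothOperator_of_matrix (a : ℕ → ℕ → ℂ)
    (ha : ∀ N : ℕ, ∃ C : ℝ, ∀ i j : ℕ,
      ‖a i j‖ ≤ C * (((i : ℝ) + 1) ^ N)⁻¹ * (((j : ℝ) + 1) ^ N)⁻¹) :
    ∃ y : SmoothOperator, ∀ (ξ : SlowSeq) (i : ℕ), (y ξ).1 i = ∑' j, a i j * ξ.1 j := by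
  have hrow : ∀ p q : ℕ, ∃ C : ℝ, ∀ i j : ℕ,
      ‖a i j‖ ≤ C * (((i : ℝ) + 1) ^ (p + 1))⁻¹ * (((j : ℝ) + 1) ^ (q + 2))⁻¹ := by
    intro p q
    obtain ⟨C, hC⟩ := ha (p + q + 2)
    have hC0 : 0 ≤ C := by simpa using (norm_nonneg _).trans (hC 0 0)
    refine ⟨C, fun i j => (hC i j).trans ?_⟩
    have hi : (1 : ℝ) ≤ (i : ℝ) + 1 := by simp
    have hj : (1 : ℝ) ≤ (j : ℝ) + 1 := by simp
    gcongr <;> first | assumption | omega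
  choose C hC using hrow
  have hsum : ∀ (ξ : SlowSeq) (i : ℕ), Summable fun j => a i j * ξ.1 j := by
    rintro ⟨ξ, q, hξ⟩ i
    exact Summable.of_norm_bounded (summable_inv_natCast_add_one_sq.mul_left _)
      (norm_mul_slowSeq_le (hC 0 q i) ⟨ξ, hξ⟩)
  have hbd : ∀ (p q : ℕ) (ξ : weightedL2 (-(q : ℤ))) (i : ℕ),
      ‖∑' j, a i j * ξ.1 j‖ ≤ (C p q * weightedNorm (-(q : ℤ)) ξ *
        ∑' j : ℕ, (((j : ℝ) + 1) ^ 2)⁻¹) * (((i : ℝ) + 1) ^ (p + 1))⁻¹ := by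
    intro p q ξ i
    refine (tsum_of_norm_bounded (summable_inv_natCast_add_one_sq.mul_left _).hasSum
      (norm_mul_slowSeq_le (hC p q i) ξ)).trans (le_of_eq ?_)
    rw [tsum_mul_left]; ring
  have hmem : ∀ ξ : SlowSeq, (fun i => ∑' j, a i j * ξ.1 j) ∈ ⨅ p : ℕ, weightedL2 (p : ℤ) := by
    rintro ⟨ξ, q, hξ⟩
    rw [Submodule.mem_iInf]
    intro p
    exact (mem_weightedL2_of_norm_le p (hbd p q ⟨ξ, hξ⟩)).1
  let y : SlowSeq →ₗ[ℂ] RapidSeq :=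
    { toFun := fun ξ => ⟨fun i => ∑' j, a i j * ξ.1 j, hmem ξ⟩
      map_add' := fun ξ η => Subtype.ext <| funext fun i => by
        change ∑' j, a i j * (ξ.1 j + η.1 j) = (∑' j, a i j * ξ.1 j) + ∑' j, a i j * η.1 j
        simp only [mul_add]
        exact (hsum ξ i).tsum_add (hsum η i)
      map_smul' := fun c ξ => Subtype.ext <| funext fun i => by
        change ∑' j, a i j * (c * ξ.1 j) = c * ∑' j, a i j * ξ.1 j
        rw [← tsum_mul_left]
        exact tsum_congr fun j => mul_left_comm _ _ _ }
  have hy : Continuous y := by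
    refine WithSeminorms.continuous_of_isBounded SlowSeq.withSeminorms RapidSeq.withSeminorms y ?_
    intro p
    -- Each seminorm of s pulled back along y is itself one of the seminorms defining the topology
    -- of s', which gives continuity at once.
    have hp : IsStepContinuous ((rapidNorm p).comp y) := by
      intro q
      refine ⟨C p q * (∑' j : ℕ, (((j : ℝ) + 1) ^ 2)⁻¹) *
        Real.sqrt (∑' j : ℕ, (((j : ℝ) + 1) ^ 2)⁻¹), fun ξ => ?_⟩
      refine (mem_weightedL2_of_norm_le p (hbd p q ξ)).2.trans (le_of_eq ?_)
      ring
    refine ⟨{⟨_, hp⟩}, 1, ?_⟩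
    rw [Finset.sup_singleton, one_smul]
    exact le_rfl
  exact ⟨⟨y, hy⟩, fun _ _ => rfl⟩

theorem exists_smoothOperator_toL2_eq (S : HilbertL2 →L[ℂ] HilbertL2)
    (hS : ∀ N : ℕ, ∃ C : ℝ, ∀ i j : ℕ, ‖S (lp.single 2 j 1) i‖ ≤
      C * (((i : ℝ) + 1) ^ N)⁻¹ * (((j : ℝ) + 1) ^ N)⁻¹) :
    ∃ y : SmoothOperator, y.toL2 = S := by
  obtain ⟨y, hy⟩ := exists_smoothOperator_of_matrix (fun i j => S (lp.single 2 j 1) i) hS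
  refine ⟨y, ContinuousLinearMap.ext fun ξ => lp.ext (funext fun i => ?_)⟩
  change (y (l2ToSlow ξ)).1 i = _
  rw [hy]
  let L : HilbertL2 →L[ℂ] ℂ := innerSL ℂ (lp.single 2 i (1 : ℂ) : HilbertL2) ∘L S
  have hL : ∀ η, L η = S η i := fun η => by
    change inner ℂ (lp.single 2 i (1 : ℂ) : HilbertL2) (S η) = _
    rw [lp.inner_single_left]; simp
  have h := (lp.hasSum_single ENNReal.ofNat_ne_top ξ).mapL L
  rw [hL] at h
  rw [← h.tsum_eq]
  refine tsum_congr fun j => ?_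
  have h1 : (lp.single 2 j (ξ j) : HilbertL2) = ξ j • lp.single 2 j (1 : ℂ) := by
    rw [← lp.single_smul, smul_eq_mul, mul_one]
  rw [h1, map_smul, hL, smul_eq_mul, mul_comm]
  rfl

/-! ### Discreteness of the nonzero spectrum. -/

/-- The nonzero spectrum of a normal Hilbert–Schmidt operator accumulates only at zero. -/
theorem finite_spectrum_inter_norm_ge {T : HilbertL2 →L[ℂ] HilbertL2} (hT : IsStarNormal T)
    (hs : Summable fun j : ℕ => ‖T (lp.single 2 j 1)‖ ^ 2) {r : ℝ} (hr : 0 < r) :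
    (spectrum ℂ T ∩ {z | r ≤ ‖z‖}).Finite := by
  classical
  by_contra hinf
  -- The m spectral points will give m orthonormal vectors with ‖T v‖ ≥ r / 2, too many for the
  -- Hilbert–Schmidt sum.
  obtain ⟨m, hm⟩ := exists_nat_gt ((∑' j : ℕ, ‖T (lp.single 2 j 1)‖ ^ 2) / (r / 2) ^ 2)
  obtain ⟨s, hsub, hcard⟩ := Set.Infinite.exists_subset_card_eq hinf m
  -- The first factor kills the disc of radius r / 2; the product is nonzero only at points strictly
  -- closer to w than to the rest of s (a Voronoi cell), so distinct bumps have product zero.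
  let φ : ℂ → ℂ → ℝ := fun w z =>
    max (‖z‖ - r / 2) 0 * ∏ w' ∈ s.erase w, max (‖z - w'‖ - ‖z - w‖) 0
  have hφc : ∀ w, Continuous (φ w) := fun w => by
    dsimp only [φ]
    fun_prop
  have hφ0 : ∀ w z, ‖z‖ ≤ r / 2 → φ w z = 0 := fun w z hz => by
    dsimp only [φ]
    rw [max_eq_right (by linarith), zero_mul]
  have hφw : ∀ w ∈ s, φ w w ≠ 0 := fun w hw => by
    have h1 : r ≤ ‖w‖ := (hsub hw).2
    refine mul_ne_zero (lt_max_of_lt_left (by linarith)).ne' (Finset.prod_ne_zero_iff.2 ?_)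
    intro w' hw'
    refine (lt_max_of_lt_left ?_).ne'
    rw [sub_self, norm_zero, sub_zero, norm_pos_iff, sub_ne_zero]
    exact (Finset.ne_of_mem_erase hw').symm
  have hφφ : ∀ w ∈ s, ∀ w' ∈ s, w ≠ w' → ∀ z, φ w z * φ w' z = 0 := by
    intro w hw w' hw' hne z
    rcases le_total ‖z - w‖ ‖z - w'‖ with h | h
    · refine mul_eq_zero_of_right _ (mul_eq_zero_of_right _ ?_)
      refine Finset.prod_eq_zero (Finset.mem_erase.2 ⟨hne, hw⟩) (max_eq_right ?_)
      linarith
    · refine mul_eq_zero_of_left (mul_eq_zero_of_right _ ?_) _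
      refine Finset.prod_eq_zero (Finset.mem_erase.2 ⟨hne.symm, hw'⟩) (max_eq_right ?_)
      linarith
  let P : ℂ → HilbertL2 →L[ℂ] HilbertL2 := fun w => cfc (fun z => (φ w z : ℂ)) T
  have hPc : ∀ w, Continuous fun z => (φ w z : ℂ) := fun w =>
    Complex.continuous_ofReal.comp (hφc w)
  have hPne : ∀ w : s, ∃ u, P w u ≠ 0 := by
    intro w
    by_contra! h
    have h0 : P w = cfc (fun _ : ℂ => (0 : ℂ)) T := by
      rw [cfc_const_zero]
      exact ContinuousLinearMap.ext h
    -- The continuous calculus is faithful on the spectrum, which contains w.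
    have h1 := (cfc_eq_cfc_iff_eqOn (hf := (hPc w).continuousOn)).1 h0 (hsub w.2).1
    exact hφw w w.2 (Complex.ofReal_eq_zero.1 h1)
  choose u hu using hPne
  let v : s → HilbertL2 := fun w => ((‖P w (u w)‖⁻¹ : ℝ) : ℂ) • P w (u w)
  have hv : Orthonormal ℂ v := by
    constructor
    · intro w
      rw [norm_smul, Complex.norm_real, norm_inv, norm_norm]
      exact inv_mul_cancel₀ (norm_ne_zero_iff.2 (hu w))
    · intro w w' hne
      have h0 : star (P w) * P w' = 0 := by
        dsimp only [P]
        rw [← cfc_star, ← cfc_mul (fun z => star (φ w z : ℂ)) _ T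
          (hPc w).star.continuousOn (hPc w').continuousOn, ← cfc_const_zero ℂ T]
        refine cfc_congr fun z _ => ?_
        simp only [RCLike.star_def, Complex.conj_ofReal]
        exact_mod_cast hφφ w w.2 w' w'.2 (Subtype.coe_injective.ne hne) z
      have h1 : inner ℂ (P w (u w)) (P w' (u w')) = 0 := by
        rw [← ContinuousLinearMap.adjoint_inner_right, ← ContinuousLinearMap.star_eq_adjoint,
          ← mul_apply_eq_comp, h0]
        simp
      simp only [v, inner_smul_left, inner_smul_right, h1, mul_zero]
  have hlow : ∀ w : s, (r / 2) ^ 2 ≤ ‖T (v w)‖ ^ 2 := by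
    intro w
    have h := le_norm_apply_cfc T hT (half_pos hr) _ (hPc w)
      (fun z hz => by rw [hφ0 w z hz, Complex.ofReal_zero])
      (((‖P w (u w)‖⁻¹ : ℝ) : ℂ) • u w)
    rw [map_smul] at h
    have h1 : ‖v w‖ = 1 := hv.1 w
    change r / 2 * ‖v w‖ ≤ ‖T (v w)‖ at h
    rw [h1, mul_one] at h
    gcongr
  have h1 := sum_sq_norm_apply_le hT hs hv
  have h2 : (m : ℝ) * (r / 2) ^ 2 ≤ ∑ w : s, ‖T (v w)‖ ^ 2 := by
    have := Finset.card_nsmul_le_sum Finset.univ (fun w : s => ‖T (v w)‖ ^ 2) _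
      fun w _ => hlow w
    simpa [hcard] using this
  rw [div_lt_iff₀ (by positivity)] at hm
  linarith

theorem SmoothOperator.finite_spectrum_inter_norm_ge (x : SmoothOperator)
    (hx : IsStarNormal x.toL2) {r : ℝ} (hr : 0 < r) :
    (spectrum ℂ x.toL2 ∩ {z | r ≤ ‖z‖}).Finite := by
  refine _root_.finite_spectrum_inter_norm_ge hx ?_ hr
  obtain ⟨C, hC⟩ := x.norm_toL2_single_le 1
  refine Summable.of_nonneg_of_le (fun _ => by positivity) (fun j => ?_)
    (summable_inv_natCast_add_one_sq.mul_left (C ^ 2))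
  refine (pow_le_pow_left₀ (norm_nonneg _) (hC j) 2).trans (le_of_eq ?_)
  rw [mul_pow, pow_one, inv_pow]

/-! ### Functions that are Hölder continuous at zero. -/

/-- A function that is Hölder continuous at zero is continuous on every set whose points
accumulate only at zero. -/
theorem HolderAtZeroOn.continuousOn {f : ℂ → ℂ} {X : Set ℂ} (hf : HolderAtZeroOn f X)
    (hX : ∀ r : ℝ, 0 < r → (X ∩ {z | r ≤ ‖z‖}).Finite) : ContinuousOn f X := by
  intro z _
  by_cases hz : z = 0
  · subst hz
    obtain ⟨θ, hθ, -, C, -, h⟩ := hf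
    have h1 : Tendsto (fun t : ℂ => C * ‖t‖ ^ θ) (𝓝[X] 0) (𝓝 0) := by
      have : Continuous fun t : ℂ => C * ‖t‖ ^ θ :=
        continuous_const.mul (continuous_norm.rpow_const fun _ => Or.inr hθ.le)
      have h2 := (this.tendsto 0).mono_left (nhdsWithin_le_nhds (s := X))
      simpa [Real.zero_rpow hθ.ne'] using h2
    rw [ContinuousWithinAt, tendsto_iff_norm_sub_tendsto_zero]
    exact squeeze_zero' (Eventually.of_forall fun _ => norm_nonneg _) h h1
  · have hr : 0 < ‖z‖ / 2 := half_pos (norm_pos_iff.2 hz)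
    have hfin := hX _ hr
    have h1 : ContinuousWithinAt f (X ∩ {w | ‖z‖ / 2 ≤ ‖w‖}) z := by
      by_cases hzm : z ∈ X ∩ {w | ‖z‖ / 2 ≤ ‖w‖}
      · exact hfin.continuousOn f z hzm
      · exact continuousWithinAt_of_notMem_closure (by rwa [hfin.isClosed.closure_eq])
    refine (continuousWithinAt_inter ?_).1 h1
    refine (continuous_norm.tendsto z).eventually (Ici_mem_nhds ?_)
    linarith [norm_pos_iff.2 hz]

/-- A function that is Hölder continuous at zero and vanishes there factors through a dyadic
power of the absolute value. -/
theorem HolderAtZeroOn.exists_factorization {f : ℂ → ℂ} {X : Set ℂ} (hf : HolderAtZeroOn f X)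
    (hc : ContinuousOn f X) (h0 : f 0 = 0) :
    ∃ (n : ℕ) (g : ℂ → ℂ), ContinuousOn g X ∧ ∀ z,
      f z = ((‖z‖ ^ ((1 / 2 : ℝ) ^ n) : ℝ) : ℂ) *
        (g z * ((‖z‖ ^ ((1 / 2 : ℝ) ^ n) : ℝ) : ℂ)) := by
  obtain ⟨θ, hθ, -, C, -, h⟩ := hf
  -- With a < θ / 2 the quotient is bounded near 0 by C‖t‖^(θ - 2a), which tends to 0; this matches
  -- the value 0 / 0 = 0 there.
  obtain ⟨n, hn⟩ := exists_pow_lt_of_lt_one (half_pos hθ) (by norm_num : (1 / 2 : ℝ) < 1)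
  set a : ℝ := (1 / 2 : ℝ) ^ n with ha
  have ha0 : 0 < a := by positivity
  have hh : Continuous fun z : ℂ => ((‖z‖ ^ a : ℝ) : ℂ) :=
    Complex.continuous_ofReal.comp (continuous_norm.rpow_const fun _ => Or.inr ha0.le)
  have hne : ∀ z : ℂ, z ≠ 0 → ((‖z‖ ^ a : ℝ) : ℂ) ≠ 0 := fun z hz => by
    exact_mod_cast (Real.rpow_pos_of_pos (norm_pos_iff.2 hz) a).ne'
  refine ⟨n, fun z => f z / (((‖z‖ ^ a : ℝ) : ℂ) * ((‖z‖ ^ a : ℝ) : ℂ)), ?_, fun z => ?_⟩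
  · intro z hz
    by_cases hz0 : z = 0
    · subst hz0
      have h1 : Tendsto (fun t : ℂ => C * ‖t‖ ^ (θ - 2 * a)) (𝓝[X] 0) (𝓝 0) := by
        have : Continuous fun t : ℂ => C * ‖t‖ ^ (θ - 2 * a) :=
          continuous_const.mul (continuous_norm.rpow_const fun _ => Or.inr (by linarith))
        have h2 := (this.tendsto 0).mono_left (nhdsWithin_le_nhds (s := X))
        rwa [norm_zero, Real.zero_rpow (by linarith), mul_zero] at h2
      rw [ContinuousWithinAt, h0, zero_div]
      refine squeeze_zero_norm' (h.mono fun t ht => ?_) h1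
      by_cases ht0 : t = 0
      · subst ht0
        rw [h0, zero_div, norm_zero, Real.zero_rpow (by linarith), mul_zero]
      · have htp : 0 < ‖t‖ := norm_pos_iff.2 ht0
        rw [h0, sub_zero] at ht
        rw [norm_div, norm_mul, Complex.norm_real, Real.norm_of_nonneg (by positivity),
          ← Real.rpow_add htp, Real.rpow_sub htp, ← two_mul, ← mul_div_assoc]
        gcongr
    · exact (hc z hz).div (hh.mul hh).continuousWithinAt (mul_ne_zero (hne z hz0) (hne z hz0))
  · by_cases hz0 : z = 0
    · subst hz0
      rw [h0, norm_zero, Real.zero_rpow ha0.ne']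
      simp
    · have := hne z hz0
      rw [← ha]
      field_simp

/-! ### Functional calculus of smooth operators. -/

theorem SmoothOperator.norm_cfc_dyadic_single_le (x : SmoothOperator)
    (hx : IsStarNormal x.toL2) (n N : ℕ) :
    ∃ C : ℝ, 0 ≤ C ∧ ∀ j : ℕ,
      ‖cfc (fun z : ℂ => ((‖z‖ ^ ((1 / 2 : ℝ) ^ n) : ℝ) : ℂ)) x.toL2 (lp.single 2 j 1)‖
        ≤ C * (((j : ℝ) + 1) ^ N)⁻¹ := by
  -- Taking the 2^n-th root divides the decay exponent by 2^n. The constant `max C 1` dominates the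
  -- root of C.
  obtain ⟨C, hC⟩ := x.norm_toL2_single_le (N * 2 ^ n)
  refine ⟨max C 1, by positivity, fun j => ?_⟩
  have h := norm_cfc_dyadic_pow_le x.toL2 hx n (norm_lp_single_one j).le
  refine (pow_le_pow_iff_left₀ (norm_nonneg _) (by positivity) (pow_ne_zero n two_ne_zero)).1
    ((h.trans (hC j)).trans ?_)
  rw [mul_pow, inv_pow, ← pow_mul]
  gcongr
  exact (le_max_left C 1).trans (le_self_pow₀ (le_max_right C 1) (by positivity))

theorem SmoothOperator.exists_toL2_eq_cfc (x : SmoothOperator) (hx : IsStarNormal x.toL2)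
    {f : ℂ → ℂ} (hf : HolderAtZeroOn f (spectrum ℂ x.toL2))
    (hc : ContinuousOn f (spectrum ℂ x.toL2)) (h0 : f 0 = 0) :
    ∃ y : SmoothOperator, y.toL2 = cfc f x.toL2 := by
  obtain ⟨n, g, hg, hfg⟩ := hf.exists_factorization hc h0
  set h : ℂ → ℂ := fun z => ((‖z‖ ^ ((1 / 2 : ℝ) ^ n) : ℝ) : ℂ) with hh
  have hhc : Continuous h :=
    Complex.continuous_ofReal.comp (continuous_norm.rpow_const fun _ => Or.inr (by positivity))
  have hstar : star (cfc h x.toL2) = cfc h x.toL2 := by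
    rw [← cfc_star]
    refine cfc_congr fun z _ => ?_
    simp [hh]
  have hfac : cfc f x.toL2 = star (cfc h x.toL2) * (cfc g x.toL2 * cfc h x.toL2) := by
    rw [hstar, ← cfc_mul g h x.toL2 hg hhc.continuousOn,
      ← cfc_mul h (fun z => g z * h z) x.toL2 hhc.continuousOn (hg.mul hhc.continuousOn)]
    exact cfc_congr fun z _ => hfg z
  refine exists_smoothOperator_toL2_eq _ fun N => ?_
  obtain ⟨C, hC0, hC⟩ := x.norm_cfc_dyadic_single_le hx n N
  refine ⟨C * ‖cfc g x.toL2‖ * C, fun i j => ?_⟩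
  have h1 : cfc f x.toL2 (lp.single 2 j 1) i = inner ℂ (cfc h x.toL2 (lp.single 2 i 1))
      (cfc g x.toL2 (cfc h x.toL2 (lp.single 2 j 1))) := by
    have h2 := lp.inner_single_left (𝕜 := ℂ) (G := fun _ : ℕ => ℂ) i (1 : ℂ)
      (cfc f x.toL2 (lp.single 2 j 1))
    rw [hfac, mul_apply_eq_comp, ContinuousLinearMap.star_eq_adjoint,
      ContinuousLinearMap.adjoint_inner_right] at h2
    rw [hfac, ContinuousLinearMap.star_eq_adjoint]
    simpa using h2.symm
  rw [h1]
  calc _ ≤ ‖cfc h x.toL2 (lp.single 2 i 1)‖ *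
        (‖cfc g x.toL2‖ * ‖cfc h x.toL2 (lp.single 2 j 1)‖) :=
        (norm_inner_le_norm _ _).trans (by gcongr; exact ContinuousLinearMap.le_opNorm _ _)
    _ ≤ (C * (((i : ℝ) + 1) ^ N)⁻¹) * (‖cfc g x.toL2‖ * (C * (((j : ℝ) + 1) ^ N)⁻¹)) := by
        gcongr
        · exact hC i
        · exact hC j
    _ = _ := by ring

theorem holderAtZeroOn_cpow {θ : ℝ} (hθ : 0 < θ) (X : Set ℂ) :
    HolderAtZeroOn (fun z : ℂ => z ^ (θ : ℂ)) X := by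
  -- Exponents above 1 are lowered to 1, which is harmless where ‖t‖ ≤ 1.
  refine ⟨min θ 1, lt_min hθ one_pos, min_le_right _ _, 1, one_pos, ?_⟩
  have h1 : ∀ᶠ t : ℂ in 𝓝[X] 0, ‖t‖ ≤ 1 := by
    refine nhdsWithin_le_nhds ?_
    filter_upwards [Metric.closedBall_mem_nhds (0 : ℂ) one_pos] with t ht
    simpa using ht
  filter_upwards [h1] with t ht
  rw [Complex.zero_cpow (by exact_mod_cast hθ.ne'), sub_zero, Complex.norm_cpow_real, one_mul]
  exact Real.rpow_le_rpow_of_exponent_ge' (norm_nonneg t) ht (lt_min hθ one_pos).le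
    (min_le_left _ _)

theorem mainTheorem4 :
    (∀ x : SmoothOperator, IsStarNormal x.toL2 →
      ∀ f : ℂ → ℂ, HolderAtZeroOn f (spectrum ℂ x.toL2) → f 0 = 0 →
        ContinuousOn f (spectrum ℂ x.toL2) ∧
          ∃ y : SmoothOperator, y.toL2 = cfc f x.toL2) ∧
    (∀ x : SmoothOperator, IsStarNormal x.toL2 →
      (∀ z ∈ spectrum ℂ x.toL2, 0 ≤ z.re ∧ z.im = 0) →
        ∀ θ : ℝ, 0 < θ →
          ∃ y : SmoothOperator, y.toL2 = cfc (fun z : ℂ => z ^ (θ : ℂ)) x.toL2) := by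
  have main : ∀ x : SmoothOperator, IsStarNormal x.toL2 →
      ∀ f : ℂ → ℂ, HolderAtZeroOn f (spectrum ℂ x.toL2) → f 0 = 0 →
        ContinuousOn f (spectrum ℂ x.toL2) ∧
          ∃ y : SmoothOperator, y.toL2 = cfc f x.toL2 := by
    intro x hx f hf h0
    have hc := hf.continuousOn fun r hr => x.finite_spectrum_inter_norm_ge hx hr
    exact ⟨hc, x.exists_toL2_eq_cfc hx hf hc h0⟩
  refine ⟨main, fun x hx _ θ hθ => (main x hx _ (holderAtZeroOn_cpow hθ _) ?_).2⟩
  exact Complex.zero_cpow (by exact_mod_cast hθ.ne')
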